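/- Let $G=(V,E)$ be a finite simple graph with a weight $\omega:V\times V\to[0,\infty)$, i.e. $\omega(x,x)=0$, $\omega(x,y)=\omega(y,x)$, and $\omega(x,y)>0$ if and only if $\{x,y\}\in E$. Let $S\subset V$ be a set of vertices whose induced subgraph is connected, let $\partial S$ be the set of vertices of $V\setminus S$ that are adjacent to some vertex of $S$, and put $\overline S=S\cup\partial S$. Let $p>1$, let $f:\mathbb R\to\mathbb R$ be locally Lipschitz continuous, let $\mu,\sigma:\partial S\to[0,\infty)$ satisfy $\mu(z)+\sigma(z)>0$ for all $z\in\partial S$, and let $u_0:S\to[0,\infty)$. For $v:\overline S\to\mathbb R$ write $$\Delta_{p,\omega}v(x)=\sum_{y\in\overline S}|v(y)-v(x)|^{p-2}[v(y)-v(x)]\,\omega(x,y)\quad(x\in S),$$ $$B[v](z)=\mu(z)\sum_{x\in S}|v(z)-v(x)|^{p-2}[v(z)-v(x)]\,\omega(x,z)+\sigma(z)|v(z)|^{p-2}v(z)\quad(z\in\partial S),$$ where $|s|^{p-2}s$ means $0$ at $s=0$. Theorem (Local existence). There exist $t_0>0$ and a bounded function $u:\overline S\times[0,t_0]\to\mathbb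 R$ such that for each $x\in\overline S$ the function $u(x,\cdot)$ is continuous on $[0,t_0]$ and differentiable in $(0,t_0)$, and $$\begin{cases}u_t(x,t)=\Delta_{p,\omega}u(x,t)+f(u(x,t)),&(x,t)\in S\times(0,t_0),\\ B[u(\cdot,t)](z)=0,&(z,t)\in\partial S\times[0,t_0],\\ u(x,0)=u_0(x),&x\in S.\end{cases}$$ Moreover, the boundary values of $u$ are determined by its values on $S$ through the boundary condition: for all $z\in\partial S$ and $t\in[0,t_0]$, if $v:\overline S\to\mathbb R$ satisfies $v=u(\cdot,t)$ on $S$ and $B[v](z)=0$, then $v(z)=u(z,t)$. -/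

import Mathlib

namespace PNetwork

/-- `ω` is a weight on the graph `G`: a symmetric nonnegative function on pairs of vertices,
vanishing on the diagonal and positive exactly on the edges. -/
structure IsWeight {V : Type*} (G : SimpleGraph V) (ω : V → V → ℝ) : Prop where
  nonneg : ∀ x y, 0 ≤ ω x y
  diag : ∀ x, ω x x = 0
  symm : ∀ x y, ω x y = ω y x
  pos_iff : ∀ x y, 0 < ω x y ↔ G.Adj x y

/-- The vertex boundary `∂S`: the vertices outside `S` adjacent to some vertex of `S`. -/
def boundary {V : Type*} [Fintype V] [DecidableEq V] (G : SimpleGraph V) [DecidableRel G.Adj]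
    (S : Finset V) : Finset V :=
  Finset.univ.filter fun z => z ∉ S ∧ ∃ y ∈ S, G.Adj z y

/-- The vertex set of `S̄`, that is `S ∪ ∂S`. -/
def closure {V : Type*} [Fintype V] [DecidableEq V] (G : SimpleGraph V) [DecidableRel G.Adj]
    (S : Finset V) : Finset V :=
  S ∪ boundary G S

/-- The odd power `|s| ^ (p - 2) * s`; it is `0` at `s = 0`. -/
noncomputable def oddPow (p s : ℝ) : ℝ := |s| ^ (p - 2) * s

/-- The discrete `p`-Laplacian at `x`; only the values of `v` on `S ∪ ∂S` and at `x` enter. -/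
noncomputable def pLaplacian {V : Type*} [Fintype V] [DecidableEq V] (G : SimpleGraph V)
    [DecidableRel G.Adj] (S : Finset V) (ω : V → V → ℝ) (p : ℝ) (v : V → ℝ) (x : V) : ℝ :=
  ∑ y ∈ closure G S, oddPow p (v y - v x) * ω x y

/-- The discrete `p`-normal derivative at a boundary vertex `z`. -/
noncomputable def pNormalDeriv {V : Type*} (S : Finset V) (ω : V → V → ℝ) (p : ℝ)
    (v : V → ℝ) (z : V) : ℝ :=
  ∑ x ∈ S, oddPow p (v z - v x) * ω x z

/-- The boundary operator `B[v](z) = μ(z) ∂v/∂ₚn (z) + σ(z) |v(z)|^(p-2) v(z)`. -/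
noncomputable def boundaryOp {V : Type*} (S : Finset V) (ω : V → V → ℝ) (p : ℝ)
    (μ σ : V → ℝ) (v : V → ℝ) (z : V) : ℝ :=
  μ z * pNormalDeriv S ω p v z + σ z * oddPow p (v z)

/-- `u` solves `u_t = Δ_{p,ω} u + f(u)` in `S × (0, t₀)`, `B[u] = 0` on `∂S × [0, t₀]` and
`u(·, 0) = u₀` on `S`. The first clause includes the existence of the time derivative. -/
structure IsSolution {V : Type*} [Fintype V] [DecidableEq V] (G : SimpleGraph V)
    [DecidableRel G.Adj] (S : Finset V) (ω : V → V → ℝ) (p : ℝ) (μ σ : V → ℝ) (f : ℝ → ℝ)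
    (u₀ : V → ℝ) (t₀ : ℝ) (u : V → ℝ → ℝ) : Prop where
  evolution : ∀ x ∈ S, ∀ t ∈ Set.Ioo 0 t₀,
    HasDerivAt (u x) (pLaplacian G S ω p (fun y => u y t) x + f (u x t)) t
  boundary_eq : ∀ z ∈ boundary G S, ∀ t ∈ Set.Icc 0 t₀,
    boundaryOp S ω p μ σ (fun y => u y t) z = 0
  initial : ∀ x ∈ S, u x 0 = u₀ x

end PNetwork

/-! At a boundary vertex, `B[v](z) = 0` reads `∑ wᵢ |c - aᵢ|^(p-2) (c - aᵢ) = 0` in `c = v z`, with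
an extra node `0` of weight `σ z`. The left side is strictly increasing in `c`, so its root is
unique and continuous in the nodes. Substituting the roots turns the problem into an autonomous ODE
with a continuous field; for `p < 2` it need not be Lipschitz, so Peano's theorem supplies the
solution.

Differentiability of the boundary values in time is the delicate point: the implicit function
theorem fails where `c` meets a node, as the odd power then has derivative `0` or `∞` unless `p =
2`. Instead the equation is rescaled along lines through the root
(`exists_tendsto_mul_weightedOddPow`). The limit is an equation of the same type in the slope, and
its unique root is the derivative (`differentiableAt_of_weightedOddPow_eq_zero`). -/

/-! ### Peano's existence theorem -/

section Peano

open Set Metric Filter Topology MeasureTheory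
open scoped NNReal BoundedContinuousFunction

variable {E : Type*} [NormedAddCommGroup E] [NormedSpace ℝ E]

/-- Picard–Lindelöf on `[0, T]` for a `C¹` vector field, with the Lipschitz bound on the solution
that depends only on the supremum of the field. -/
theorem ContDiff.exists_lipschitz_eq_integral [FiniteDimensional ℝ E] {g : E → E} {x₀ : E}
    {T : ℝ} {L : ℝ≥0} (hg : ContDiff ℝ 1 g) (hT : 0 ≤ T)
    (hL : ∀ x ∈ closedBall x₀ 1, ‖g x‖ ≤ L) (hLT : L * T ≤ 1) :
    ∃ α : Icc (0 : ℝ) T →ᵇ E, LipschitzWith L α ∧ (∀ t, α t ∈ closedBall x₀ 1) ∧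
      ∀ t, α t = x₀ + ∫ τ in (0 : ℝ)..t, g (α (projIcc 0 T hT τ)) := by
  have : CompleteSpace E := FiniteDimensional.complete ℝ E
  have : ProperSpace E := FiniteDimensional.proper ℝ E
  obtain ⟨K, hK⟩ := hg.contDiffOn.exists_lipschitzOnWith one_ne_zero (convex_closedBall x₀ (1 : ℝ))
    (isCompact_closedBall x₀ 1)
  have hpl : IsPicardLindelof (fun _ => g) (⟨0, le_rfl, hT⟩ : Icc (0 : ℝ) T) x₀ 1 0 L K := by
    apply IsPicardLindelof.of_time_independent
    · simpa using hL
    · simpa using hK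
    · simpa [max_eq_left hT] using hLT
  obtain ⟨α, hα⟩ := ODE.FunSpace.exists_isFixedPt_next hpl (mem_closedBall_self le_rfl)
  rw [ODE.FunSpace.isFixedPt_next_iff] at hα
  refine ⟨BoundedContinuousFunction.mkOfCompact α.toContinuousMap, α.lipschitzWith, fun t => ?_,
    hα⟩
  simpa using α.mem_closedBall hpl.mul_max_le (t := t)

/-- **Peano existence theorem** for an autonomous continuous vector field. -/
theorem Continuous.exists_hasDerivWithinAt_Icc [FiniteDimensional ℝ E] {F : E → E}
    (hF : Continuous F) (x₀ : E) :
    ∃ T : ℝ, 0 < T ∧ ∃ y : ℝ → E, y 0 = x₀ ∧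
      ∀ t ∈ Icc 0 T, HasDerivWithinAt y (F (y t)) (Icc 0 T) t := by
  have : CompleteSpace E := FiniteDimensional.complete ℝ E
  have : ProperSpace E := FiniteDimensional.proper ℝ E
  obtain ⟨C, hC⟩ := (isCompact_closedBall x₀ (1 : ℝ)).exists_bound_of_continuousOn hF.continuousOn
  have hC0 : 0 ≤ C := (norm_nonneg _).trans (hC x₀ (mem_closedBall_self zero_le_one))
  -- The extra `1` absorbs the approximation error, so all `g n` share one bound and one time
  -- interval.
  let L : ℝ≥0 := ⟨C + 1, by positivity⟩
  have hLpos : (0 : ℝ) < L := show 0 < C + 1 by positivity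
  let T : ℝ := 1 / L
  have hT : 0 < T := by positivity
  have hLT : L * T ≤ 1 := le_of_eq (mul_one_div_cancel hLpos.ne')
  have happrox (n : ℕ) : ∃ g : E → E, ContDiff ℝ 1 g ∧ ∀ x, dist (g x) (F x) < 1 / (n + 1 : ℝ) := by
    obtain ⟨g, hg, hgF, -⟩ := hF.exists_contDiff_approx 1 (ε := fun _ => 1 / (n + 1 : ℝ))
      continuous_const fun _ => by positivity
    exact ⟨g, hg, hgF⟩
  choose g hg hgF using happrox
  have hgL (n : ℕ) (x : E) (hx : x ∈ closedBall x₀ 1) : ‖g n x‖ ≤ L := by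
    have h1 : ‖g n x - F x‖ ≤ 1 := by
      rw [← dist_eq_norm]
      refine (hgF n x).le.trans ?_
      rw [div_le_one (by positivity)]
      linarith [n.cast_nonneg (α := ℝ)]
    have h2 := norm_le_norm_add_norm_sub' (g n x) (F x)
    have h3 := hC x hx
    change ‖g n x‖ ≤ C + 1
    linarith
  choose α hαL hαmem hα using fun n => (hg n).exists_lipschitz_eq_integral hT.le (hgL n) hLT
  have hcomp : IsCompact (_root_.closure (range α)) := by
    refine BoundedContinuousFunction.arzela_ascoli (closedBall x₀ 1) (isCompact_closedBall _ _) _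
      ?_ ?_
    · rintro _ x ⟨n, rfl⟩
      exact hαmem n x
    · refine (LipschitzWith.uniformEquicontinuous _ L ?_).equicontinuous
      rintro ⟨_, n, rfl⟩
      exact hαL n
  obtain ⟨β, -, φ, hφ, hlim⟩ := hcomp.tendsto_subseq fun n => subset_closure (mem_range_self n)
  have hpt (t : Icc (0 : ℝ) T) : Tendsto (fun n => α (φ n) t) atTop (𝓝 (β t)) :=
    ((BoundedContinuousFunction.lipschitz_eval_const t).continuous.tendsto β).comp hlim
  have hgpt (t : Icc (0 : ℝ) T) : Tendsto (fun n => g (φ n) (α (φ n) t)) atTop (𝓝 (F (β t))) := by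
    refine ((hF.tendsto _).comp (hpt t)).congr_dist ?_
    refine squeeze_zero (fun _ => dist_nonneg) (fun n => ?_)
      (tendsto_one_div_add_atTop_nhds_zero_nat.comp hφ.tendsto_atTop)
    rw [dist_comm]
    exact (hgF _ _).le
  have hβ (t : Icc (0 : ℝ) T) :
      β t = x₀ + ∫ τ in (0 : ℝ)..t, F (β (projIcc 0 T hT.le τ)) := by
    refine tendsto_nhds_unique (hpt t) ?_
    simp_rw [hα (φ _) t]
    refine tendsto_const_nhds.add ?_
    refine intervalIntegral.tendsto_integral_filter_of_dominated_convergence (fun _ => (L : ℝ))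
      ?_ ?_ intervalIntegrable_const ?_
    · refine Eventually.of_forall fun n => Continuous.aestronglyMeasurable ?_
      exact (hg _).continuous.comp ((α (φ n)).continuous.comp continuous_projIcc)
    · exact Eventually.of_forall fun n => .of_forall fun τ _ => hgL _ _ (hαmem _ _)
    · exact .of_forall fun τ _ => hgpt _
  have hcont : Continuous fun τ => F (β (projIcc 0 T hT.le τ)) :=
    hF.comp (β.continuous.comp continuous_projIcc)
  refine ⟨T, hT, fun t => β (projIcc 0 T hT.le t), ?_, fun t ht => ?_⟩
  · have := hβ ⟨0, le_rfl, hT.le⟩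
    simpa [projIcc_of_mem hT.le (show (0 : ℝ) ∈ Icc 0 T from ⟨le_rfl, hT.le⟩)] using this
  · have hd : HasDerivAt (fun t => x₀ + ∫ τ in (0 : ℝ)..t, F (β (projIcc 0 T hT.le τ)))
        (F (β (projIcc 0 T hT.le t))) t :=
      (hcont.integral_hasStrictDerivAt 0 t).hasDerivAt.const_add x₀
    refine hd.hasDerivWithinAt.congr (fun s hs => ?_) ?_
    · rw [projIcc_of_mem hT.le hs]
      exact hβ ⟨s, hs⟩
    · rw [projIcc_of_mem hT.le ht]
      exact hβ ⟨t, ht⟩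

end Peano

namespace PNetwork

/-! ### The odd power function -/

section OddPow

variable {p : ℝ}

@[simp]
theorem oddPow_zero : oddPow p 0 = 0 := by simp [oddPow]

theorem oddPow_neg (s : ℝ) : oddPow p (-s) = -oddPow p s := by simp [oddPow]

theorem oddPow_mul (s t : ℝ) : oddPow p (s * t) = oddPow p s * oddPow p t := by
  simp only [oddPow, abs_mul, Real.mul_rpow (abs_nonneg s) (abs_nonneg t)]
  ring

theorem oddPow_two (s : ℝ) : oddPow 2 s = s := by simp [oddPow]

theorem oddPow_mul_self_pos {s : ℝ} (hs : s ≠ 0) : 0 < oddPow p s * s := by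
  have h1 := Real.rpow_pos_of_pos (abs_pos.2 hs) (p - 2)
  have h2 := mul_self_pos.2 hs
  rw [oddPow, mul_assoc]
  positivity

theorem oddPow_ne_zero {s : ℝ} (hs : s ≠ 0) : oddPow p s ≠ 0 :=
  left_ne_zero_of_mul (oddPow_mul_self_pos hs).ne'

theorem oddPow_of_nonneg (hp : 1 < p) {s : ℝ} (hs : 0 ≤ s) : oddPow p s = s ^ (p - 1) := by
  rcases hs.eq_or_lt with rfl | hs
  · rw [oddPow_zero, Real.zero_rpow (by linarith)]
  · rw [oddPow, abs_of_pos hs, ← Real.rpow_add_one hs.ne']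
    congr 1
    ring

/-- Only the positive exponent `p - 1` occurs here, which gives continuity at `0` even when `|s| ^
(p - 2)` is singular. -/
theorem oddPow_eq_sub (hp : 1 < p) (s : ℝ) :
    oddPow p s = max s 0 ^ (p - 1) - max (-s) 0 ^ (p - 1) := by
  have h0 : (0 : ℝ) ^ (p - 1) = 0 := Real.zero_rpow (by linarith)
  rcases le_total 0 s with hs | hs
  · rw [max_eq_left hs, max_eq_right (neg_nonpos.2 hs), h0, sub_zero, oddPow_of_nonneg hp hs]
  · rw [max_eq_right hs, max_eq_left (neg_nonneg.2 hs), h0, zero_sub,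
      ← oddPow_of_nonneg hp (neg_nonneg.2 hs), oddPow_neg, neg_neg]

theorem continuous_oddPow (hp : 1 < p) : Continuous (oddPow p) := by
  have h : 0 ≤ p - 1 := by linarith
  rw [funext (oddPow_eq_sub hp)]
  exact ((continuous_id.max continuous_const).rpow_const fun _ => Or.inr h).sub
    ((continuous_neg.max continuous_const).rpow_const fun _ => Or.inr h)

theorem strictMono_oddPow (hp : 1 < p) : StrictMono (oddPow p) := by
  refine strictMono_of_odd_strictMonoOn_nonneg oddPow_neg fun s hs t ht hst => ?_
  rw [oddPow_of_nonneg hp hs, oddPow_of_nonneg hp ht]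
  exact Real.rpow_lt_rpow hs hst (by linarith)

theorem oddPow_nonneg {s : ℝ} (hs : 0 ≤ s) : 0 ≤ oddPow p s :=
  mul_nonneg (Real.rpow_nonneg (abs_nonneg s) _) hs

theorem oddPow_nonpos {s : ℝ} (hs : s ≤ 0) : oddPow p s ≤ 0 :=
  mul_nonpos_of_nonneg_of_nonpos (Real.rpow_nonneg (abs_nonneg s) _) hs

theorem exists_hasDerivAt_oddPow (hp : 1 < p) {s : ℝ} (hs : s ≠ 0) :
    ∃ k : ℝ, 0 < k ∧ HasDerivAt (oddPow p) k s := by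
  have key : ∀ {x : ℝ}, 0 < x → HasDerivAt (oddPow p) ((p - 1) * x ^ (p - 1 - 1)) x := by
    intro x hx
    refine (Real.hasDerivAt_rpow_const (Or.inl hx.ne')).congr_of_eventuallyEq ?_
    filter_upwards [eventually_gt_nhds hx] with y hy using oddPow_of_nonneg hp hy.le
  have kpos : ∀ {x : ℝ}, 0 < x → 0 < (p - 1) * x ^ (p - 1 - 1) := fun {x} hx =>
    mul_pos (by linarith) (Real.rpow_pos_of_pos hx _)
  rcases hs.lt_or_gt with hs | hs
  · have h := ((key (neg_pos.2 hs)).comp s (hasDerivAt_neg s)).fun_neg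
    simp only [Function.comp_apply, oddPow_neg, neg_neg, mul_neg, mul_one] at h
    exact ⟨_, kpos (neg_pos.2 hs), h⟩
  · exact ⟨_, kpos hs, key hs⟩

end OddPow

/-! ### Weighted sums of odd powers and their roots -/

section WeightedOddPow

open Filter Topology

variable {ι : Type*} {p : ℝ} {w : ι → ℝ}

/-- A nonnegative weight that does not vanish identically. -/
structure IsNontrivialWeight (w : ι → ℝ) : Prop where
  nonneg : ∀ i, 0 ≤ w i
  exists_pos : ∃ i, 0 < w i

theorem IsNontrivialWeight.mul (hw : IsNontrivialWeight w) {k : ι → ℝ} (hk : ∀ i, 0 < k i) :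
    IsNontrivialWeight fun i => w i * k i :=
  ⟨fun i => mul_nonneg (hw.nonneg i) (hk i).le,
    hw.exists_pos.imp fun i hi => mul_pos hi (hk i)⟩

variable [Fintype ι]

/-- The derivative in `c` of `∑ i, w i * |c - a i| ^ p / p`. -/
noncomputable def weightedOddPow (p : ℝ) (w a : ι → ℝ) (c : ℝ) : ℝ :=
  ∑ i, w i * oddPow p (c - a i)

theorem strictMono_weightedOddPow (hp : 1 < p) (hw : IsNontrivialWeight w) (a : ι → ℝ) :
    StrictMono (weightedOddPow p w a) := by
  intro c d hcd
  obtain ⟨i, hi⟩ := hw.exists_pos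
  have h (j : ι) : oddPow p (c - a j) < oddPow p (d - a j) :=
    strictMono_oddPow hp (sub_lt_sub_right hcd _)
  exact Finset.sum_lt_sum (fun j _ => mul_le_mul_of_nonneg_left (h j).le (hw.nonneg j))
    ⟨i, Finset.mem_univ i, mul_lt_mul_of_pos_left (h i) hi⟩

theorem continuous_weightedOddPow (hp : 1 < p) (w : ι → ℝ) :
    Continuous fun x : (ι → ℝ) × ℝ => weightedOddPow p w x.1 x.2 :=
  continuous_finsetSum _ fun i _ => continuous_const.mul <|
    (continuous_oddPow hp).comp (by fun_prop)

theorem exists_weightedOddPow_eq_zero (hp : 1 < p) (hw : ∀ i, 0 ≤ w i) (a : ι → ℝ) :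
    ∃ c, weightedOddPow p w a c = 0 := by
  have hM (i : ι) : |a i| ≤ ‖a‖ := norm_le_pi_norm a i
  have hc : Continuous (weightedOddPow p w a) :=
    (continuous_weightedOddPow hp w).comp (by fun_prop : Continuous fun c : ℝ => (a, c))
  refine mem_range_of_exists_le_of_exists_ge hc ⟨-‖a‖, ?_⟩ ⟨‖a‖, ?_⟩
  · exact Finset.sum_nonpos fun i _ => mul_nonpos_of_nonneg_of_nonpos (hw i) <|
      oddPow_nonpos (by linarith [neg_abs_le (a i), hM i])
  · exact Finset.sum_nonneg fun i _ => mul_nonneg (hw i) <|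
      oddPow_nonneg (by linarith [le_abs_self (a i), hM i])

/-- By monotonicity, `c < g a` amounts to a negative sign at `c`, an open condition on `a`; likewise
for `g a < c`. -/
theorem continuous_of_weightedOddPow_eq_zero (hp : 1 < p) (hw : IsNontrivialWeight w)
    {g : (ι → ℝ) → ℝ} (hg : ∀ a, weightedOddPow p w a (g a) = 0) : Continuous g := by
  have hc (c : ℝ) : Continuous fun a => weightedOddPow p w a c :=
    (continuous_weightedOddPow hp w).comp (by fun_prop : Continuous fun a : ι → ℝ => (a, c))
  have hmono := strictMono_weightedOddPow hp hw
  refine continuous_iff_continuousAt.2 fun a => tendsto_order.2 ⟨fun c hcg => ?_, fun c hcg => ?_⟩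
  · have h : weightedOddPow p w a c < 0 := hg a ▸ hmono a hcg
    filter_upwards [(hc c).continuousAt.eventually_lt_const h] with b hb
    exact (hmono b).lt_iff_lt.1 (by rwa [hg b])
  · have h : 0 < weightedOddPow p w a c := hg a ▸ hmono a hcg
    filter_upwards [(hc c).continuousAt.eventually_const_lt h] with b hb
    exact (hmono b).lt_iff_lt.1 (by rwa [hg b])

/-! ### Leading-order asymptotics and differentiability of the root -/

theorem tendsto_inv_mul_of_hasDerivAt {f : ℝ → ℝ} {f' t₀ : ℝ} (hf : HasDerivAt f f' t₀)
    (h0 : f t₀ = 0) : Tendsto (fun t => (t - t₀)⁻¹ * f t) (𝓝[≠] t₀) (𝓝 f') := by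
  refine (hasDerivAt_iff_tendsto_slope.1 hf).congr fun t => ?_
  rw [slope_def_field, h0, sub_zero, div_eq_inv_mul]

theorem tendsto_sub_nhdsNE (t₀ : ℝ) : Tendsto (fun t => t - t₀) (𝓝[≠] t₀) (𝓝[≠] 0) := by
  refine tendsto_nhdsWithin_iff.2 ⟨?_, ?_⟩
  · have h : Continuous fun t : ℝ => t - t₀ := by fun_prop
    simpa using (h.tendsto t₀).mono_left nhdsWithin_le_nhds
  · filter_upwards [self_mem_nhdsWithin] with t ht using sub_ne_zero.2 ht

theorem tendsto_oddPow_div_self (hp : 2 < p) :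
    Tendsto (fun s => s⁻¹ * oddPow p s) (𝓝[≠] 0) (𝓝 0) := by
  have h : Continuous fun s : ℝ => |s| ^ (p - 2) :=
    continuous_abs.rpow_const fun _ => Or.inr (by linarith)
  have h0 := (h.tendsto 0).mono_left (nhdsWithin_le_nhds (s := {0}ᶜ))
  rw [abs_zero, Real.zero_rpow (by linarith)] at h0
  refine h0.congr' ?_
  filter_upwards [self_mem_nhdsWithin] with s hs
  have hs : s ≠ 0 := hs
  rw [oddPow]
  field_simp

theorem tendsto_self_div_oddPow (hp : p < 2) :
    Tendsto (fun s => (oddPow p s)⁻¹ * s) (𝓝[≠] 0) (𝓝 0) := by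
  have h : Continuous fun s : ℝ => |s| ^ (2 - p) :=
    continuous_abs.rpow_const fun _ => Or.inr (by linarith)
  have h0 := (h.tendsto 0).mono_left (nhdsWithin_le_nhds (s := {0}ᶜ))
  rw [abs_zero, Real.zero_rpow (by linarith)] at h0
  refine h0.congr' ?_
  filter_upwards [self_mem_nhdsWithin] with s hs
  have hs : s ≠ 0 := hs
  rw [oddPow, show 2 - p = -(p - 2) by ring, Real.rpow_neg (abs_nonneg s)]
  field_simp

variable {A : ℝ → ι → ℝ} {β : ι → ℝ} {t₀ c₀ : ℝ}

/-- If no node with positive weight sits at `c₀`, the first-order behaviour along a line is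
linear. -/
theorem tendsto_inv_mul_weightedOddPow (hp : 1 < p) (hA : ∀ i, HasDerivAt (fun t => A t i) (β i) t₀)
    (hw : ∀ i, 0 ≤ w i) (hne : ∀ i, 0 < w i → c₀ ≠ A t₀ i)
    (h0 : weightedOddPow p w (A t₀) c₀ = 0) :
    ∃ k : ι → ℝ, (∀ i, 0 < k i) ∧ ∀ d, Tendsto
      (fun t => (t - t₀)⁻¹ * weightedOddPow p w (A t) (c₀ + (t - t₀) * d)) (𝓝[≠] t₀)
      (𝓝 (weightedOddPow 2 (fun i => w i * k i) β d)) := by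
  have hk (i : ι) : ∃ k : ℝ, 0 < k ∧ (0 < w i → HasDerivAt (oddPow p) k (c₀ - A t₀ i)) := by
    by_cases hi : 0 < w i
    · obtain ⟨k, hk, hd⟩ := exists_hasDerivAt_oddPow hp (sub_ne_zero.2 (hne i hi))
      exact ⟨k, hk, fun _ => hd⟩
    · exact ⟨1, one_pos, fun h => absurd h hi⟩
  choose k hkpos hk using hk
  refine ⟨k, hkpos, fun d => tendsto_inv_mul_of_hasDerivAt ?_ (by simpa using h0)⟩
  refine HasDerivAt.fun_sum fun i _ => ?_
  rcases (hw i).eq_or_lt with hi | hi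
  · simpa [← hi] using hasDerivAt_const t₀ (0 : ℝ)
  · have h1 : HasDerivAt (fun t => c₀ + (t - t₀) * d - A t i) (d - β i) t₀ := by
      simpa using ((((hasDerivAt_id t₀).sub_const t₀).mul_const d).const_add c₀).fun_sub (hA i)
    have h2 : HasDerivAt (oddPow p) (k i) (c₀ + (t₀ - t₀) * d - A t₀ i) := by
      simpa using hk i hi
    have h3 := (h2.comp t₀ h1).const_mul (w i)
    rw [oddPow_two, mul_assoc]
    exact h3

/-- If all nodes with positive weight sit at `c₀`, the behaviour along a line is homogeneous. -/
theorem tendsto_inv_oddPow_mul_weightedOddPow (hp : 1 < p)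
    (hA : ∀ i, HasDerivAt (fun t => A t i) (β i) t₀) (heq : ∀ i, w i ≠ 0 → c₀ = A t₀ i) (d : ℝ) :
    Tendsto (fun t => (oddPow p (t - t₀))⁻¹ * weightedOddPow p w (A t) (c₀ + (t - t₀) * d))
      (𝓝[≠] t₀) (𝓝 (weightedOddPow p w β d)) := by
  simp only [weightedOddPow, Finset.mul_sum]
  refine tendsto_finsetSum _ fun i _ => ?_
  by_cases hi : w i = 0
  · simp [hi]
  -- By multiplicativity the prefactor moves inside `oddPow`, leaving a difference quotient with
  -- limit `d - β i`.
  have h1 : HasDerivAt (fun t => c₀ + (t - t₀) * d - A t i) (d - β i) t₀ := by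
    simpa using ((((hasDerivAt_id t₀).sub_const t₀).mul_const d).const_add c₀).fun_sub (hA i)
  have h2 := tendsto_inv_mul_of_hasDerivAt h1 (by simp [heq i hi])
  have h3 := (((continuous_oddPow hp).tendsto _).comp h2).const_mul (w i)
  refine h3.congr' ?_
  filter_upwards [self_mem_nhdsWithin] with t ht
  have h4 := oddPow_ne_zero (p := p) (sub_ne_zero.2 (show t ≠ t₀ from ht))
  have h5 : oddPow p ((t - t₀)⁻¹) = (oddPow p (t - t₀))⁻¹ := by
    refine eq_inv_of_mul_eq_one_left ?_
    rw [← oddPow_mul, inv_mul_cancel₀ (sub_ne_zero.2 ht)]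
    simp [oddPow]
  simp only [Function.comp_apply, oddPow_mul, h5]
  ring

/-- The leading-order behaviour along a line through a zero, after a suitable rescaling. -/
theorem exists_tendsto_mul_weightedOddPow (hp : 1 < p) (hw : IsNontrivialWeight w)
    (hA : ∀ i, HasDerivAt (fun t => A t i) (β i) t₀)
    (h0 : weightedOddPow p w (A t₀) c₀ = 0) :
    ∃ (q : ℝ) (w' : ι → ℝ) (r : ℝ → ℝ), 1 < q ∧ IsNontrivialWeight w' ∧
      (∀ᶠ t in 𝓝[≠] t₀, 0 < r t * (t - t₀)) ∧
      ∀ d, Tendsto (fun t => r t * weightedOddPow p w (A t) (c₀ + (t - t₀) * d)) (𝓝[≠] t₀)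
        (𝓝 (weightedOddPow q w' β d)) := by
  classical
  -- `wI` collects the nodes sitting at `c₀`, `wJ` the others.
  let wI : ι → ℝ := fun i => if c₀ = A t₀ i then w i else 0
  let wJ : ι → ℝ := fun i => if c₀ = A t₀ i then 0 else w i
  have hwI0 (i : ι) : 0 ≤ wI i := by dsimp only [wI]; split_ifs <;> simp [hw.nonneg]
  have hwJ0 (i : ι) : 0 ≤ wJ i := by dsimp only [wJ]; split_ifs <;> simp [hw.nonneg]
  have hsum (i : ι) : w i = wJ i + wI i := by dsimp only [wI, wJ]; split_ifs <;> simp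
  have hsplit (b : ι → ℝ) (c : ℝ) :
      weightedOddPow p w b c = weightedOddPow p wJ b c + weightedOddPow p wI b c := by
    simp only [weightedOddPow, ← Finset.sum_add_distrib, ← add_mul, hsum]
  have hI (i : ι) (hi : wI i ≠ 0) : c₀ = A t₀ i := by
    by_contra h
    simp [wI, h] at hi
  have hJ (i : ι) (hi : 0 < wJ i) : c₀ ≠ A t₀ i := by
    intro h
    simp [wJ, h] at hi
  have hI0 : weightedOddPow p wI (A t₀) c₀ = 0 := by
    refine Finset.sum_eq_zero fun i _ => ?_
    by_cases hi : wI i = 0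
    · simp [hi]
    · simp [← hI i hi]
  have hJ0 : weightedOddPow p wJ (A t₀) c₀ = 0 := by linarith [hsplit (A t₀) c₀]
  obtain ⟨k, hk, hlimJ⟩ := tendsto_inv_mul_weightedOddPow hp hA hwJ0 hJ hJ0
  have hlimI := tendsto_inv_oddPow_mul_weightedOddPow hp hA hI
  have hr₁ : ∀ᶠ t in 𝓝[≠] t₀, 0 < (t - t₀)⁻¹ * (t - t₀) := by
    filter_upwards [self_mem_nhdsWithin] with t ht
    rw [inv_mul_cancel₀ (sub_ne_zero.2 ht)]
    exact one_pos
  have hr₂ : ∀ᶠ t in 𝓝[≠] t₀, 0 < (oddPow p (t - t₀))⁻¹ * (t - t₀) := by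
    filter_upwards [self_mem_nhdsWithin] with t ht
    have h := oddPow_mul_self_pos (p := p) (sub_ne_zero.2 (show t ≠ t₀ from ht))
    rcases pos_and_pos_or_neg_and_neg_of_mul_pos h with h | h
    · exact mul_pos (inv_pos.2 h.1) h.2
    · exact mul_pos_of_neg_of_neg (inv_lt_zero.2 h.1) h.2
  have hsub := tendsto_sub_nhdsNE t₀
  have hsplit' {u : ι → ℝ} (hu : ¬ ∃ i, 0 < u i) (hu0 : ∀ i, 0 ≤ u i) (b : ι → ℝ) (c : ℝ) :
      weightedOddPow p u b c = 0 := by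
    push Not at hu
    exact Finset.sum_eq_zero fun i _ => by simp [le_antisymm (hu i) (hu0 i)]
  have active : (∃ i, 0 < wJ i) ∨ ∃ i, 0 < wI i := by
    obtain ⟨i, hi⟩ := hw.exists_pos
    by_contra! h
    linarith [hsum i, h.1 i, h.2 i]
  -- The `wJ` part has order `|t - t₀|`, the `wI` part `|t - t₀| ^ (p - 1)`. If both carry weight,
  -- `wI` dominates for `p < 2`, `wJ` for `p > 2`, and both survive for `p = 2`.
  rcases lt_trichotomy p 2 with hp2 | rfl | hp2
  · by_cases hact : ∃ i, 0 < wI i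
    · refine ⟨p, wI, _, hp, ⟨hwI0, hact⟩, hr₂, fun d => ?_⟩
      have h := (((tendsto_self_div_oddPow hp2).comp hsub).mul (hlimJ d)).add (hlimI d)
      rw [zero_mul, zero_add] at h
      refine h.congr' ?_
      filter_upwards [self_mem_nhdsWithin] with t ht
      have ht : t - t₀ ≠ 0 := sub_ne_zero.2 ht
      simp only [Function.comp_apply]
      rw [hsplit]
      field_simp
    · refine ⟨2, _, _, one_lt_two, IsNontrivialWeight.mul ⟨hwJ0, ?_⟩ hk, hr₁, fun d => ?_⟩
      · exact active.resolve_right hact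
      · simpa only [hsplit, hsplit' hact hwI0, add_zero] using hlimJ d
  · refine ⟨2, fun i => wJ i * k i + wI i, _, hp, ⟨?_, ?_⟩, hr₁, fun d => ?_⟩
    · exact fun i => add_nonneg (mul_nonneg (hwJ0 i) (hk i).le) (hwI0 i)
    · rcases active with ⟨i, hi⟩ | ⟨i, hi⟩
      · exact ⟨i, add_pos_of_pos_of_nonneg (mul_pos hi (hk i)) (hwI0 i)⟩
      · exact ⟨i, add_pos_of_nonneg_of_pos (mul_nonneg (hwJ0 i) (hk i).le) hi⟩
    · have h := (hlimJ d).add (hlimI d)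
      simp only [oddPow_two, ← mul_add, ← hsplit] at h
      convert h using 2
      simp only [weightedOddPow, ← Finset.sum_add_distrib, ← add_mul]
  · by_cases hact : ∃ i, 0 < wJ i
    · refine ⟨2, _, _, one_lt_two, IsNontrivialWeight.mul ⟨hwJ0, hact⟩ hk, hr₁, fun d => ?_⟩
      have h := (hlimJ d).add (((tendsto_oddPow_div_self hp2).comp hsub).mul (hlimI d))
      rw [zero_mul, add_zero] at h
      refine h.congr' ?_
      filter_upwards [self_mem_nhdsWithin] with t ht
      have ht : oddPow p (t - t₀) ≠ 0 := oddPow_ne_zero (sub_ne_zero.2 ht)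
      simp only [Function.comp_apply]
      rw [hsplit]
      field_simp
    · refine ⟨p, wI, _, hp, ⟨hwI0, active.resolve_left hact⟩, hr₂, fun d => ?_⟩
      simpa only [hsplit, hsplit' hact hwJ0, zero_add] using hlimI d

/-- The zero of `weightedOddPow` depends differentiably on a parameter as soon as the nodes do. -/
theorem differentiableAt_of_weightedOddPow_eq_zero (hp : 1 < p) (hw : IsNontrivialWeight w)
    {c : ℝ → ℝ} (hA : ∀ i, HasDerivAt (fun t => A t i) (β i) t₀)
    (h0 : ∀ᶠ t in 𝓝 t₀, weightedOddPow p w (A t) (c t) = 0) : DifferentiableAt ℝ c t₀ := by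
  obtain ⟨q, w', r, hq, hw', hr, hlim⟩ := exists_tendsto_mul_weightedOddPow hp hw hA h0.self_of_nhds
  obtain ⟨d, hd⟩ := exists_weightedOddPow_eq_zero hq hw'.nonneg β
  have hmono := strictMono_weightedOddPow hq hw' β
  have hH (t : ℝ) {x y : ℝ} := (strictMono_weightedOddPow hp hw (A t)).le_iff_le (a := x) (b := y)
  refine HasDerivAt.differentiableAt (f' := d) (hasDerivAt_iff_tendsto_slope.2 ?_)
  refine tendsto_order.2 ⟨fun b hb => ?_, fun b hb => ?_⟩
  -- As `r t` has the sign of `t - t₀`, the line of slope `b < d` lies below the root to the right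
  -- of `t₀` and above it to the left; either way the slope of `c` exceeds `b`.
  · have hneg : weightedOddPow q w' β b < 0 := hd ▸ hmono hb
    filter_upwards [hr, (hlim b).eventually_lt_const hneg, h0.filter_mono nhdsWithin_le_nhds]
      with t hrt ht hct
    rw [slope_def_field]
    rcases pos_and_pos_or_neg_and_neg_of_mul_pos hrt with ⟨h1, h2⟩ | ⟨h1, h2⟩
    · rw [lt_div_iff₀ h2]
      by_contra! h
      have h3 := (hH t).2 (show c t ≤ c t₀ + (t - t₀) * b by linarith)
      rw [hct] at h3
      exact ht.not_ge (mul_nonneg h1.le h3)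
    · rw [lt_div_iff_of_neg h2]
      by_contra! h
      have h3 := (hH t).2 (show c t₀ + (t - t₀) * b ≤ c t by linarith)
      rw [hct] at h3
      exact ht.not_ge (mul_nonneg_of_nonpos_of_nonpos h1.le h3)
  · have hpos : 0 < weightedOddPow q w' β b := hd ▸ hmono hb
    filter_upwards [hr, (hlim b).eventually_const_lt hpos, h0.filter_mono nhdsWithin_le_nhds]
      with t hrt ht hct
    rw [slope_def_field]
    rcases pos_and_pos_or_neg_and_neg_of_mul_pos hrt with ⟨h1, h2⟩ | ⟨h1, h2⟩
    · rw [div_lt_iff₀ h2]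
      by_contra! h
      have h3 := (hH t).2 (show c t₀ + (t - t₀) * b ≤ c t by linarith)
      rw [hct] at h3
      exact ht.not_ge (mul_nonpos_of_nonneg_of_nonpos h1.le h3)
    · rw [div_lt_iff_of_neg h2]
      by_contra! h
      have h3 := (hH t).2 (show c t ≤ c t₀ + (t - t₀) * b by linarith)
      rw [hct] at h3
      exact ht.not_ge (mul_nonpos_of_nonpos_of_nonneg h1.le h3)

end WeightedOddPow

end PNetwork

namespace PNetwork

/-! ### The boundary condition as a weighted sum -/

section BoundaryValues

open Filter Topology

variable {V : Type*} [DecidableEq V]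

/-- The weights that turn the boundary operator at `z` into a `weightedOddPow`; the node `none`
carries the zeroth-order term. -/
def boundaryWeight (S : Finset V) (ω : V → V → ℝ) (μ σ : V → ℝ) (z : V) : Option V → ℝ
  | none => σ z
  | some x => if x ∈ S then μ z * ω x z else 0

/-- The values of `v`, together with the value `0` at the extra node. -/
def boundaryNodes (v : V → ℝ) : Option V → ℝ
  | none => 0
  | some x => v x

variable [Fintype V] {G : SimpleGraph V} [DecidableRel G.Adj] {S : Finset V} {ω : V → V → ℝ}
  {p : ℝ} {μ σ : V → ℝ} {z : V}

/-- If `σ z = 0` then `μ z > 0`, and a neighbour of `z` in `S` carries positive weight. -/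
theorem isNontrivialWeight_boundaryWeight (hω : IsWeight G ω) (hz : z ∈ boundary G S)
    (hμ : 0 ≤ μ z) (hσ : 0 ≤ σ z) (hμσ : 0 < μ z + σ z) :
    IsNontrivialWeight (boundaryWeight S ω μ σ z) := by
  refine ⟨?_, ?_⟩
  · rintro (_ | x)
    · exact hσ
    · rw [boundaryWeight]
      split_ifs
      · exact mul_nonneg hμ (hω.nonneg x z)
      · exact le_rfl
  · rcases hσ.eq_or_lt with h | h
    · obtain ⟨-, -, x, hx, hadj⟩ := Finset.mem_filter.1 hz
      refine ⟨some x, ?_⟩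
      rw [boundaryWeight, if_pos hx]
      exact mul_pos (by linarith) ((hω.pos_iff x z).2 hadj.symm)
    · exact ⟨none, h⟩

omit [DecidableRel G.Adj] in
theorem weightedOddPow_boundaryWeight {a v : V → ℝ} (hav : ∀ x ∈ S, a x = v x) :
    weightedOddPow p (boundaryWeight S ω μ σ z) (boundaryNodes a) (v z) =
      boundaryOp S ω p μ σ v z := by
  have hsum : ∑ x, (if x ∈ S then μ z * ω x z else 0) * oddPow p (v z - a x) =
      μ z * pNormalDeriv S ω p v z := by
    simp only [ite_mul, zero_mul, Finset.sum_ite_mem, Finset.univ_inter, pNormalDeriv,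
      Finset.mul_sum]
    refine Finset.sum_congr rfl fun x hx => ?_
    rw [hav x hx]
    ring
  simp only [weightedOddPow, Fintype.sum_option, boundaryWeight, boundaryNodes, hsum, boundaryOp,
    sub_zero]
  ring

end BoundaryValues

end PNetwork

/-! ### Local existence -/

theorem mainTheorem2 {V : Type*} [Fintype V] [DecidableEq V]
    (G : SimpleGraph V) [DecidableRel G.Adj]
    (ω : V → V → ℝ) (hω : PNetwork.IsWeight G ω)
    (S : Finset V) (hS : (G.induce (S : Set V)).Connected)
    (p : ℝ) (hp : 1 < p)
    (f : ℝ → ℝ) (hf : LocallyLipschitz f)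
    (μ σ : V → ℝ)
    (hμ : ∀ z ∈ PNetwork.boundary G S, 0 ≤ μ z)
    (hσ : ∀ z ∈ PNetwork.boundary G S, 0 ≤ σ z)
    (hμσ : ∀ z ∈ PNetwork.boundary G S, 0 < μ z + σ z)
    (u₀ : V → ℝ) (hu₀ : ∀ x ∈ S, 0 ≤ u₀ x) :
    ∃ t₀ : ℝ, 0 < t₀ ∧ ∃ u : V → ℝ → ℝ,
      PNetwork.IsSolution G S ω p μ σ f u₀ t₀ u ∧
      (∃ M : ℝ, ∀ x ∈ PNetwork.closure G S, ∀ t ∈ Set.Icc 0 t₀, |u x t| ≤ M) ∧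
      (∀ x ∈ PNetwork.closure G S,
        ContinuousOn (u x) (Set.Icc 0 t₀) ∧ DifferentiableOn ℝ (u x) (Set.Ioo 0 t₀)) ∧
      (∀ z ∈ PNetwork.boundary G S, ∀ t ∈ Set.Icc 0 t₀, ∀ v : V → ℝ,
        (∀ x ∈ S, v x = u x t) → PNetwork.boundaryOp S ω p μ σ v z = 0 → v z = u z t) := by
  have hW := fun z hz => PNetwork.isNontrivialWeight_boundaryWeight (S := S) hω hz (hμ z hz)
    (hσ z hz) (hμσ z hz)
  have hex (z : V) (hz : z ∈ PNetwork.boundary G S) : ∃ g : (Option V → ℝ) → ℝ,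
      ∀ a, PNetwork.weightedOddPow p (PNetwork.boundaryWeight S ω μ σ z) a (g a) = 0 := by
    choose g hg using PNetwork.exists_weightedOddPow_eq_zero hp (hW z hz).nonneg
    exact ⟨g, hg⟩
  choose! g hg using hex
  have hgc (z : V) (hz : z ∈ PNetwork.boundary G S) : Continuous (g z) :=
    PNetwork.continuous_of_weightedOddPow_eq_zero hp (hW z hz) (hg z hz)
  have hnodes : Continuous (PNetwork.boundaryNodes (V := V)) := by
    refine continuous_pi fun i => ?_
    rcases i with _ | x
    · exact continuous_const
    · exact continuous_apply x
  let ext (v : V → ℝ) (x : V) : ℝ :=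
    if x ∈ PNetwork.boundary G S then g x (PNetwork.boundaryNodes v) else v x
  have ext_boundary {z : V} (hz : z ∈ PNetwork.boundary G S) (v : V → ℝ) :
      ext v z = g z (PNetwork.boundaryNodes v) := if_pos hz
  have ext_mem {x : V} (hx : x ∈ S) (v : V → ℝ) : ext v x = v x :=
    if_neg fun h => (Finset.mem_filter.1 h).2.1 hx
  have ext_cont (x : V) : Continuous fun v => ext v x := by
    by_cases hx : x ∈ PNetwork.boundary G S
    · simp only [ext_boundary hx]
      exact (hgc x hx).comp hnodes
    · simp only [ext, if_neg hx]
      exact continuous_apply x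
  -- The ODE lives on all of `V → ℝ`; components outside `S` are auxiliary, since `ext` overwrites
  -- them on `∂S` and `boundaryWeight` gives them weight zero.
  let F (v : V → ℝ) (x : V) : ℝ := PNetwork.pLaplacian G S ω p (ext v) x + f (v x)
  have hF : Continuous F := by
    refine continuous_pi fun x => .add ?_ (hf.continuous.comp (continuous_apply x))
    exact continuous_finsetSum _ fun y _ => .mul
      ((PNetwork.continuous_oddPow hp).comp ((ext_cont y).sub (ext_cont x))) continuous_const
  obtain ⟨T, hT, y, hy0, hy⟩ := hF.exists_hasDerivWithinAt_Icc u₀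
  have hyc : ContinuousOn y (Set.Icc 0 T) := fun t ht => (hy t ht).continuousWithinAt
  have hyd (t : ℝ) (ht : t ∈ Set.Ioo 0 T) (x : V) :
      HasDerivAt (fun s => y s x) (F (y t) x) t :=
    hasDerivAt_pi.1 ((hy t (Set.Ioo_subset_Icc_self ht)).hasDerivAt (Icc_mem_nhds ht.1 ht.2)) x
  have huc (x : V) : ContinuousOn (fun t => ext (y t) x) (Set.Icc 0 T) :=
    (ext_cont x).comp_continuousOn hyc
  have hext (x : V) (hx : x ∈ S) : (fun t => ext (y t) x) = fun t => y t x :=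
    funext fun t => ext_mem hx _
  have hud (t : ℝ) (ht : t ∈ Set.Ioo 0 T) (x : V) (hx : x ∈ S) :
      HasDerivAt (fun s => ext (y s) x)
        (PNetwork.pLaplacian G S ω p (ext (y t)) x + f (ext (y t) x)) t := by
    rw [hext x hx, ext_mem hx]
    exact hyd t ht x
  refine ⟨T, hT, fun x t => ext (y t) x, ⟨fun x hx t ht => hud t ht x hx, fun z hz t _ => ?_,
    fun x hx => ?_⟩, ?_, fun x hx => ⟨huc x, fun t ht => ?_⟩, fun z hz t _ v hv hB => ?_⟩
  · rw [← PNetwork.weightedOddPow_boundaryWeight (a := y t) fun x hx => (ext_mem hx _).symm,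
      ext_boundary hz]
    exact hg z hz _
  · rw [ext_mem hx, hy0]
  · obtain ⟨M, hM⟩ := isCompact_Icc.exists_bound_of_continuousOn (continuousOn_pi.2 huc)
    exact ⟨M, fun x _ t ht => (norm_le_pi_norm (fun x => ext (y t) x) x).trans (hM t ht)⟩
  · refine DifferentiableAt.differentiableWithinAt ?_
    rcases Finset.mem_union.1 hx with hx | hx
    · exact (hud t ht x hx).differentiableAt
    · refine PNetwork.differentiableAt_of_weightedOddPow_eq_zero hp (hW x hx)
        (A := fun t => PNetwork.boundaryNodes (y t)) (β := PNetwork.boundaryNodes (F (y t))) ?_ ?_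
      · rintro (_ | i)
        · exact hasDerivAt_const t (0 : ℝ)
        · exact hyd t ht i
      · refine .of_forall fun s => ?_
        beta_reduce
        rw [ext_boundary hx]
        exact hg x hx _
  · refine (PNetwork.strictMono_weightedOddPow hp (hW z hz)
      (PNetwork.boundaryNodes (y t))).injective ?_
    rw [PNetwork.weightedOddPow_boundaryWeight fun x hx => ((hv x hx).trans (ext_mem hx _)).symm, hB]
    beta_reduce
    rw [ext_boundary hz, hg z hz]
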